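/- A pattern of length $k$ is a permutation $q=q_1q_2\cdots q_k$ of $\{1,\dots,k\}$. A copy of $q$ in a permutation $p=p_1\cdots p_n$ is a sequence of positions $1\le j_1<\dots<j_k\le n$ such that, for all $a,b$, $p_{j_a}<p_{j_b}$ if and only if $q_a<q_b$; $p$ avoids $q$ if it has no copy of $q$. Let $S_{n,132}(q)$ be the total number of copies of $q$ in all $132$-avoiding permutations of length $n$. For patterns $q$ of length $k$ and $t$ of length $m$, let $q\oplus t$ and $q\ominus t$ be the patterns of length $k+m$ given by $$(q\oplus t)_i=\begin{cases} q_i & i\le k,\\ t_{i-k}+k & i>k,\end{cases}\qquad (q\ominus t)_i=\begin{cases} q_i+m & i\le k,\\ t_{i-k} & i>k,\end{cases}$$ and let $i_u=12\cdots u$ be the increasing pattern of length $u$. Let $q$ and $t$ be non-empty patterns, each of which ends in its largest entry, and let $u,v$ be integers with $1\le v<u$. Then for every integer $n\ge 0$, $$S_{n,132}\bigl(((q\oplus i_v)\ominus t)\oplus i_{u-v}\bigr)=S_{n,132}\bigl((q\ominus t)\oplus i_u\bigr),$$ and both sides are equal to $S_{n,132}\bigl((q\oplus i_u)\ominus t\bigr)$.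 -/

import Mathlib

namespace PermPattern

/-- A pattern of length `k` (equivalently a permutation of length `k`, written in one-line
notation `q 0, q 1, …, q (k - 1)`) is an element of `Equiv.Perm (Fin k)`; positions and entries
are numbered from `0`. -/
abbrev Pattern (k : ℕ) : Type := Equiv.Perm (Fin k)

/-- The increasing sequence of positions `f 0 < f 1 < … < f (k - 1)` is a copy of the pattern `q`
in the permutation `p`: the entries of `p` at these positions are in the same relative order as
the entries of `q`. -/
def IsCopy {k n : ℕ} (q : Pattern k) (p : Pattern n) (f : Fin k ↪o Fin n) : Prop :=
  ∀ a b : Fin k, p (f a) < p (f b) ↔ q a < q b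

/-- `p` contains the pattern `r`. -/
def Contains {k n : ℕ} (p : Pattern n) (r : Pattern k) : Prop :=
  ∃ f : Fin k ↪o Fin n, IsCopy r p f

/-- `p` avoids the pattern `r`. -/
def Avoids {k n : ℕ} (p : Pattern n) (r : Pattern k) : Prop :=
  ¬ Contains p r

/-- The number of copies of the pattern `q` in the permutation `p`. -/
noncomputable def copies {k n : ℕ} (q : Pattern k) (p : Pattern n) : ℕ :=
  Nat.card {f : Fin k ↪o Fin n // IsCopy q p f}

open Classical in
/-- `S n r q` is the total number of copies of `q` in all `r`-avoiding permutations of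
length `n`. -/
noncomputable def S (n : ℕ) {j k : ℕ} (r : Pattern j) (q : Pattern k) : ℕ :=
  ∑ p ∈ (Finset.univ : Finset (Pattern n)).filter (fun p => Avoids p r), copies q p

/-- The pattern `132`; numbering from `0`, its entries are `0, 2, 1`. -/
def p132 : Pattern 3 := Equiv.swap 1 2

/-- The increasing pattern `12⋯u`. -/
def incr (u : ℕ) : Pattern u := Equiv.refl (Fin u)

/-- The direct sum `q ⊕ t`: `q` followed by `t`, all entries of `t` being increased by the length
of `q`. See `oplus_castAdd` and `oplus_natAdd` for the entries. -/
def oplus {k m : ℕ} (q : Pattern k) (t : Pattern m) : Pattern (k + m) :=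
  (finSumFinEquiv.symm.trans (Equiv.sumCongr q t)).trans finSumFinEquiv

/-- The skew sum `q ⊖ t`: `q` followed by `t`, all entries of `q` being increased by the length
of `t`. See `ominus_castAdd` and `ominus_natAdd` for the entries. -/
def ominus {k m : ℕ} (q : Pattern k) (t : Pattern m) : Pattern (k + m) :=
  (((finSumFinEquiv.symm.trans (Equiv.sumCongr q t)).trans (Equiv.sumComm (Fin k) (Fin m))).trans
    finSumFinEquiv).trans (finCongr (Nat.add_comm m k))

/-- The pattern `q` is non-empty and its last entry is its largest entry. -/
def EndsInLargest {k : ℕ} (q : Pattern k) : Prop :=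
  ∃ h : 0 < k, ∀ i : Fin k, q i ≤ q ⟨k - 1, Nat.sub_lt h Nat.one_pos⟩

theorem oplus_castAdd {k m : ℕ} (q : Pattern k) (t : Pattern m) (i : Fin k) :
    (oplus q t (Fin.castAdd m i) : ℕ) = q i := by
  simp [oplus]

theorem oplus_natAdd {k m : ℕ} (q : Pattern k) (t : Pattern m) (i : Fin m) :
    (oplus q t (Fin.natAdd k i) : ℕ) = t i + k := by
  simp [oplus, Nat.add_comm]

theorem ominus_castAdd {k m : ℕ} (q : Pattern k) (t : Pattern m) (i : Fin k) :
    (ominus q t (Fin.castAdd m i) : ℕ) = q i + m := by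
  simp [ominus, Nat.add_comm]

theorem ominus_natAdd {k m : ℕ} (q : Pattern k) (t : Pattern m) (i : Fin m) :
    (ominus q t (Fin.natAdd k i) : ℕ) = t i := by
  simp [ominus]

end PermPattern

/-! A non-empty permutation avoids 132 exactly when it is (L ⊕ 1) ⊖ R with L, R avoiding 132, and
then L and R are unique (`sum_avoiders_succ`). Let C be the generating function of the avoiders, F_q
that of the copies of q in them, Y = xC and D = 1 - 2Y.

A copy of q ⊕ 1 ends in its largest entry, so it lies within L ⊕ 1 or within R; hence D F_{q⊕1} = Y
F_q (`copiesGenFun_oplus_one`). A copy of (q ⊕ 1) ⊖ (t ⊕ 1) lies in L, lies in R, or splits at the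
⊖; hence D F = x (F_{q⊕1} + F_q) F_{t⊕1} (`copiesGenFun_ominus`).

Appending i_u to any pattern multiplies its F by (Y/D)^u. Inserting i_u after q ⊕ 1 multiplies both
terms of F_{q⊕1} + F_q by that factor, so it has the same effect on the skew sum. Each of the three
patterns therefore has generating function (Y/D)^u F_{q⊖t}. Denominators are cleared throughout, and
D is cancelled as a nonzero element of a domain. -/

namespace PermPattern

/-! ### Relative order of entries in direct and skew sums. -/

section SumOrder

variable {k m : ℕ} (q : Pattern k) (t : Pattern m)

theorem oplus_left_lt_left (i j : Fin k) :
    oplus q t (Fin.castAdd m i) < oplus q t (Fin.castAdd m j) ↔ q i < q j := by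
  rw [← Fin.val_fin_lt, oplus_castAdd, oplus_castAdd, Fin.val_fin_lt]

theorem oplus_right_lt_right (i j : Fin m) :
    oplus q t (Fin.natAdd k i) < oplus q t (Fin.natAdd k j) ↔ t i < t j := by
  rw [← Fin.val_fin_lt, oplus_natAdd, oplus_natAdd, Nat.add_lt_add_iff_right, Fin.val_fin_lt]

theorem oplus_left_lt_right (i : Fin k) (j : Fin m) :
    oplus q t (Fin.castAdd m i) < oplus q t (Fin.natAdd k j) := by
  simp only [Fin.lt_def, oplus_natAdd, oplus_castAdd]; omega

theorem ominus_left_lt_left (i j : Fin k) :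
    ominus q t (Fin.castAdd m i) < ominus q t (Fin.castAdd m j) ↔ q i < q j := by
  rw [← Fin.val_fin_lt, ominus_castAdd, ominus_castAdd, Nat.add_lt_add_iff_right, Fin.val_fin_lt]

theorem ominus_right_lt_right (i j : Fin m) :
    ominus q t (Fin.natAdd k i) < ominus q t (Fin.natAdd k j) ↔ t i < t j := by
  rw [← Fin.val_fin_lt, ominus_natAdd, ominus_natAdd, Fin.val_fin_lt]

theorem ominus_right_lt_left (i : Fin k) (j : Fin m) :
    ominus q t (Fin.natAdd k j) < ominus q t (Fin.castAdd m i) := by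
  simp only [Fin.lt_def, ominus_natAdd, ominus_castAdd]; omega

theorem castAdd_lt_natAdd (i : Fin k) (j : Fin m) : Fin.castAdd m i < Fin.natAdd k j := by
  simp only [Fin.lt_def, Fin.val_castAdd, Fin.val_natAdd]; omega

theorem mem_range_castAdd_or_natAdd (x : Fin (k + m)) :
    (∃ i, Fin.castAdd m i = x) ∨ ∃ j, Fin.natAdd k j = x := by
  induction x using Fin.addCases with
  | left i => exact Or.inl ⟨i, rfl⟩
  | right j => exact Or.inr ⟨j, rfl⟩

end SumOrder

/-! ### Recognising direct and skew sums. -/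

section Decomposition

variable {k m : ℕ}

/-- Associativity of ⊕. No cast is needed, since `k + (u + 1)` and `k + u + 1` agree definitionally.
-/
theorem oplus_incr_succ (q : Pattern k) (u : ℕ) :
    oplus q (incr (u + 1)) = oplus (oplus q (incr u)) (incr 1) := by
  ext x
  induction x using Fin.addCases with
  | left i =>
    rw [oplus_castAdd]
    have h := oplus_castAdd (oplus q (incr u)) (incr 1) (Fin.castAdd u i)
    rw [oplus_castAdd q (incr u) i] at h
    exact h.symm
  | right j =>
    rw [oplus_natAdd]
    induction j using Fin.addCases with
    | left i =>
      have h := oplus_castAdd (oplus q (incr u)) (incr 1) (Fin.natAdd k i)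
      rw [oplus_natAdd] at h
      exact h.symm
    | right i =>
      have h := oplus_natAdd (oplus q (incr u)) (incr 1) i
      have e : Fin.natAdd (k + u) i = Fin.natAdd k (Fin.natAdd u i) := by
        ext; simp
      rw [e] at h
      refine Eq.trans ?_ h.symm
      simp [incr]; omega

/-- The last `m` entries are distinct and below `m`, so they exhaust those values and leave only
values at least `m` for the first `k` positions. -/
theorem exists_eq_ominus (p : Pattern (k + m)) (h : ∀ j : Fin m, (p (Fin.natAdd k j) : ℕ) < m) :
    ∃ (q : Pattern k) (t : Pattern m), p = ominus q t := by
  let t₀ : Fin m → Fin m := fun j => ⟨p (Fin.natAdd k j), h j⟩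
  have ht : Function.Injective t₀ := by
    intro i j hij
    have h1 : p (Fin.natAdd k i) = p (Fin.natAdd k j) := Fin.ext (by simpa [t₀] using hij)
    simpa using p.injective h1
  have ht' : Function.Bijective t₀ := Finite.injective_iff_bijective.1 ht
  have hle : ∀ i : Fin k, m ≤ (p (Fin.castAdd m i) : ℕ) := by
    intro i
    by_contra! hlt
    obtain ⟨j, hj⟩ := ht'.2 ⟨_, hlt⟩
    have h1 : p (Fin.natAdd k j) = p (Fin.castAdd m i) := Fin.ext (by simpa [t₀] using hj)
    exact (castAdd_lt_natAdd i j).ne (p.injective h1).symm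
  let q₀ : Fin k → Fin k := fun i => ⟨p (Fin.castAdd m i) - m, by have := hle i; omega⟩
  have hq : Function.Injective q₀ := by
    intro i j hij
    have h1 : p (Fin.castAdd m i) = p (Fin.castAdd m j) := by
      have h2 := congrArg Fin.val hij
      have hi := hle i
      have hj := hle j
      simp only [q₀] at h2
      exact Fin.ext (by omega)
    simpa using p.injective h1
  refine ⟨Equiv.ofBijective q₀ (Finite.injective_iff_bijective.1 hq), Equiv.ofBijective t₀ ht', ?_⟩
  ext x
  induction x using Fin.addCases with
  | left i =>
    rw [ominus_castAdd]
    have hi := hle i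
    simp only [Equiv.ofBijective_apply, q₀]
    omega
  | right j => rw [ominus_natAdd]; rfl

theorem exists_eq_oplus_one (p : Pattern (k + 1)) (h : p (Fin.last k) = Fin.last k) :
    ∃ q : Pattern k, p = oplus q (incr 1) := by
  have hlt : ∀ i : Fin k, (p (Fin.castAdd 1 i) : ℕ) < k := by
    intro i
    have h1 : p (Fin.castAdd 1 i) ≠ p (Fin.last k) := fun e => by
      have := congrArg Fin.val (p.injective e)
      simp at this
      omega
    rw [h] at h1
    have h2 : (p (Fin.castAdd 1 i) : ℕ) ≠ k := fun e => h1 (Fin.ext e)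
    omega
  let q₀ : Fin k → Fin k := fun i => ⟨p (Fin.castAdd 1 i), hlt i⟩
  have hq : Function.Injective q₀ := by
    intro i j hij
    have h1 : p (Fin.castAdd 1 i) = p (Fin.castAdd 1 j) := Fin.ext (by simpa [q₀] using hij)
    simpa using p.injective h1
  refine ⟨Equiv.ofBijective q₀ (Finite.injective_iff_bijective.1 hq), ?_⟩
  ext x
  induction x using Fin.addCases with
  | left i => rw [oplus_castAdd]; rfl
  | right j =>
    rw [oplus_natAdd]
    have e : Fin.natAdd k j = Fin.last k := by ext; simp
    rw [e, h]; simp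

theorem EndsInLargest.exists_eq_oplus_one {q : Pattern (k + 1)} (hq : EndsInLargest q) :
    ∃ q' : Pattern k, q = oplus q' (incr 1) := by
  obtain ⟨h, hq⟩ := hq
  refine PermPattern.exists_eq_oplus_one q ?_
  have h1 := hq (q.symm (Fin.last k))
  rw [Equiv.apply_symm_apply] at h1
  exact le_antisymm (Fin.le_last _) h1

end Decomposition

/-! ### Counting copies inside direct and skew sums. -/

section Copies

variable {k l m n N : ℕ}

theorem card_subtype_eq_add {α : Type*} [Finite α] {P A B : α → Prop}
    (h : ∀ x, P x ↔ A x ∨ B x) (hd : ∀ x, A x → ¬ B x) :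
    Nat.card {x // P x} = Nat.card {x // A x} + Nat.card {x // B x} := by
  classical
  rw [← Nat.card_sum]
  refine Nat.card_congr ((Equiv.subtypeEquivRight h).trans (subtypeOrEquiv A B ?_))
  rw [Pi.disjoint_iff]
  intro x
  rw [Prop.disjoint_iff]
  exact not_and.2 (hd x)

instance : Finite (Fin k ↪o Fin n) := Finite.of_injective _ (DFunLike.coe_injective)

theorem card_copies_in_range {q : Pattern k} {p : Pattern N} {p' : Pattern n} (g : Fin n ↪o Fin N)
    (hg : ∀ a b, p (g a) < p (g b) ↔ p' a < p' b) :
    Nat.card {f : Fin k ↪o Fin N // IsCopy q p f ∧ ∀ a, ∃ i, g i = f a} = copies q p' := by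
  symm
  refine Nat.card_eq_of_bijective
    (fun f => ⟨f.1.trans g, fun a b => (hg _ _).trans (f.2 a b), fun a => ⟨f.1 a, rfl⟩⟩) ⟨?_, ?_⟩
  · intro f f' hff
    have h1 := congrArg Subtype.val hff
    refine Subtype.ext (DFunLike.ext _ _ fun a => g.injective ?_)
    exact DFunLike.congr_fun h1 a
  · rintro ⟨f, hf, hr⟩
    have hr' := hr
    choose h hh using hr'
    refine ⟨⟨OrderEmbedding.ofMapLEIff h fun a b => ?_, fun a b => ?_⟩, ?_⟩
    · rw [← g.le_iff_le, hh, hh, f.le_iff_le]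
    · rw [← hg]
      simp only [OrderEmbedding.coe_ofMapLEIff, hh]
      exact hf a b
    · refine Subtype.ext (DFunLike.ext _ _ fun a => ?_)
      simp [hh]

/-- Copies of `q` sending a prefix of length `k` to the first `n` positions and the rest to the last
`l` positions correspond to pairs of copies of the two parts of `q`, when entries
of the two parts compare in `q` as in `p`. -/
theorem card_copies_split {q : Pattern (k + m)} {p : Pattern (n + l)} {q₁ : Pattern k}
    {q₂ : Pattern m} {p₁ : Pattern n} {p₂ : Pattern l}
    (hq₁ : ∀ a b, q (Fin.castAdd m a) < q (Fin.castAdd m b) ↔ q₁ a < q₁ b)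
    (hq₂ : ∀ a b, q (Fin.natAdd k a) < q (Fin.natAdd k b) ↔ q₂ a < q₂ b)
    (hp₁ : ∀ a b, p (Fin.castAdd l a) < p (Fin.castAdd l b) ↔ p₁ a < p₁ b)
    (hp₂ : ∀ a b, p (Fin.natAdd n a) < p (Fin.natAdd n b) ↔ p₂ a < p₂ b)
    (h₁₂ : ∀ a b i j, p (Fin.castAdd l i) < p (Fin.natAdd n j) ↔
      q (Fin.castAdd m a) < q (Fin.natAdd k b))
    (h₂₁ : ∀ a b i j, p (Fin.natAdd n j) < p (Fin.castAdd l i) ↔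
      q (Fin.natAdd k b) < q (Fin.castAdd m a)) :
    Nat.card {f : Fin (k + m) ↪o Fin (n + l) // IsCopy q p f ∧
      (∀ a, ∃ i, Fin.castAdd l i = f (Fin.castAdd m a)) ∧
      ∀ b, ∃ j, Fin.natAdd n j = f (Fin.natAdd k b)} = copies q₁ p₁ * copies q₂ p₂ := by
  rw [copies, copies, ← Nat.card_prod]
  symm
  have key : ∀ (f₁ : Fin k ↪o Fin n) (f₂ : Fin m ↪o Fin l),
      StrictMono (Fin.addCases (motive := fun _ => Fin (n + l))
        (fun a => Fin.castAdd l (f₁ a)) (fun b => Fin.natAdd n (f₂ b))) := by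
    intro f₁ f₂ x y hxy
    induction x using Fin.addCases with
    | left a =>
      induction y using Fin.addCases with
      | left b =>
        simp only [Fin.addCases_left]
        have : a < b := hxy
        exact f₁.strictMono this
      | right b =>
        simp only [Fin.addCases_left, Fin.addCases_right]
        exact castAdd_lt_natAdd _ _
    | right a =>
      induction y using Fin.addCases with
      | left b => exact absurd hxy (castAdd_lt_natAdd _ _).not_gt
      | right b =>
        simp only [Fin.addCases_right]
        have : a < b := by simpa using hxy
        simpa using this
  refine Nat.card_eq_of_bijective (fun f => ⟨OrderEmbedding.ofStrictMono _ (key f.1.1 f.2.1),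
    ?_, fun a => ⟨f.1.1 a, by simp⟩, fun b => ⟨f.2.1 b, by simp⟩⟩) ⟨?_, ?_⟩
  · intro x y
    induction x using Fin.addCases with
    | left a =>
      induction y using Fin.addCases with
      | left b => simpa [hq₁, hp₁] using f.1.2 a b
      | right b => simpa using h₁₂ a b _ _
    | right a =>
      induction y using Fin.addCases with
      | left b => simpa using h₂₁ b a _ _
      | right b => simpa [hq₂, hp₂] using f.2.2 a b
  · rintro ⟨⟨f₁, h₁⟩, ⟨f₂, h₂⟩⟩ ⟨⟨f₁', h₁'⟩, ⟨f₂', h₂'⟩⟩ hff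
    have h := congrArg Subtype.val hff
    have e₁ : f₁ = f₁' := DFunLike.ext _ _ fun a => by
      simpa using DFunLike.congr_fun h (Fin.castAdd m a)
    have e₂ : f₂ = f₂' := DFunLike.ext _ _ fun a => by
      simpa using DFunLike.congr_fun h (Fin.natAdd k a)
    subst e₁ e₂; rfl
  · rintro ⟨f, hf, hl, hr⟩
    have hl' := hl
    have hr' := hr
    choose g₁ hg₁ using hl'
    choose g₂ hg₂ using hr'
    have m₁ : StrictMono g₁ := fun a b hab => by
      have h : f (Fin.castAdd m a) < f (Fin.castAdd m b) := f.strictMono hab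
      rw [← hg₁, ← hg₁] at h
      exact h
    have m₂ : StrictMono g₂ := fun a b hab => by
      have h : f (Fin.natAdd k a) < f (Fin.natAdd k b) := f.strictMono (by simpa using hab)
      rw [← hg₂, ← hg₂] at h
      simpa using h
    refine ⟨(⟨OrderEmbedding.ofStrictMono g₁ m₁, fun a b => ?_⟩,
      ⟨OrderEmbedding.ofStrictMono g₂ m₂, fun a b => ?_⟩), ?_⟩
    · rw [← hp₁, ← hq₁, ← hf, ← hg₁, ← hg₁]; rfl
    · rw [← hp₂, ← hq₂, ← hf, ← hg₂, ← hg₂]; rfl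
    · refine Subtype.ext (DFunLike.ext _ _ fun x => ?_)
      induction x using Fin.addCases with
      | left a => simpa using hg₁ a
      | right a => simpa using hg₂ a

theorem IsCopy.le_iff {q : Pattern k} {p : Pattern n} {f : Fin k ↪o Fin n} (h : IsCopy q p f)
    (a b : Fin k) : p (f a) ≤ p (f b) ↔ q a ≤ q b := by
  rw [← not_lt, h b a, not_lt]

theorem oplus_one_le_last (q : Pattern k) (x : Fin (k + 1)) :
    oplus q (incr 1) x ≤ oplus q (incr 1) (Fin.natAdd k 0) := by
  induction x using Fin.addCases with
  | left i => exact (oplus_left_lt_right _ _ _ _).le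
  | right j => rw [Subsingleton.elim j 0]

theorem le_natAdd_zero (x : Fin (k + 1)) : x ≤ Fin.natAdd k 0 := by
  rw [Fin.le_def]; simp; omega

theorem left_of_le_left {x : Fin (n + l)} {i : Fin n} (h : x ≤ Fin.castAdd l i) :
    ∃ j, Fin.castAdd l j = x := by
  rcases mem_range_castAdd_or_natAdd x with hx | ⟨j, rfl⟩
  · exact hx
  · exact absurd h (castAdd_lt_natAdd _ _).not_ge

theorem right_of_ominus_le {p₁ : Pattern n} {p₂ : Pattern l} {x : Fin (n + l)} {j : Fin l}
    (h : ominus p₁ p₂ x ≤ ominus p₁ p₂ (Fin.natAdd n j)) : ∃ j, Fin.natAdd n j = x := by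
  rcases mem_range_castAdd_or_natAdd x with ⟨i, rfl⟩ | hx
  · exact absurd h (ominus_right_lt_left _ _ _ _).not_ge
  · exact hx

/-- The last entry of a copy decides its block. In the left block, it is rightmost, so everything is
there; in the right block, it is largest, while all left entries are larger still. -/
theorem copies_oplus_one_ominus (q : Pattern k) (p₁ : Pattern n) (p₂ : Pattern l) :
    copies (oplus q (incr 1)) (ominus p₁ p₂) =
      copies (oplus q (incr 1)) p₁ + copies (oplus q (incr 1)) p₂ := by
  rw [← card_copies_in_range (Fin.castAddOrderEmb l) (ominus_left_lt_left p₁ p₂),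
    ← card_copies_in_range (Fin.natAddOrderEmb n) (ominus_right_lt_right p₁ p₂)]
  refine card_subtype_eq_add (fun f => ⟨fun h => ?_, fun h => h.elim And.left And.left⟩) ?_
  · rcases mem_range_castAdd_or_natAdd (f (Fin.natAdd k 0)) with ⟨i, hi⟩ | ⟨j, hj⟩
    · refine Or.inl ⟨h, fun a => ?_⟩
      have h1 := f.monotone (le_natAdd_zero a)
      rw [← hi] at h1
      exact left_of_le_left h1
    · refine Or.inr ⟨h, fun a => ?_⟩
      have h1 := (h.le_iff _ _).2 (oplus_one_le_last q a)
      rw [← hj] at h1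
      exact right_of_ominus_le h1
  · rintro f ⟨-, h1⟩ ⟨-, h2⟩
    obtain ⟨i, hi⟩ := h1 (Fin.natAdd k 0)
    obtain ⟨j, hj⟩ := h2 (Fin.natAdd k 0)
    exact (castAdd_lt_natAdd i j).ne (hi.trans hj.symm)

theorem copies_incr_one : copies (incr 1) (incr 1) = 1 := by
  have : Subsingleton {f : Fin 1 ↪o Fin 1 // IsCopy (incr 1) (incr 1) f} :=
    ⟨fun f g => Subtype.ext (DFunLike.ext _ _ fun _ => Subsingleton.elim _ _)⟩
  have : Nonempty {f : Fin 1 ↪o Fin 1 // IsCopy (incr 1) (incr 1) f} :=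
    ⟨RelEmbedding.refl _, fun a b => Iff.rfl⟩
  exact Nat.card_unique

theorem copies_oplus_one_oplus_one (q : Pattern k) (p : Pattern n) :
    copies (oplus q (incr 1)) (oplus p (incr 1)) =
      copies (oplus q (incr 1)) p + copies q p := by
  have e : copies q p = copies q p * copies (incr 1) (incr 1) := by
    rw [copies_incr_one, mul_one]
  rw [e, ← card_copies_in_range (Fin.castAddOrderEmb 1) (oplus_left_lt_left p (incr 1)),
    ← card_copies_split (oplus_left_lt_left q (incr 1)) (oplus_right_lt_right q (incr 1))
      (oplus_left_lt_left p (incr 1)) (oplus_right_lt_right p (incr 1))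
      (fun a b i j => iff_of_true (oplus_left_lt_right _ _ _ _) (oplus_left_lt_right _ _ _ _))
      (fun a b i j => iff_of_false (oplus_left_lt_right _ _ _ _).not_gt
        (oplus_left_lt_right _ _ _ _).not_gt)]
  refine card_subtype_eq_add (fun f => ⟨fun h => ?_, fun h => h.elim And.left And.left⟩) ?_
  · rcases mem_range_castAdd_or_natAdd (f (Fin.natAdd k 0)) with ⟨i, hi⟩ | ⟨j, hj⟩
    · refine Or.inl ⟨h, fun a => ?_⟩
      have h1 := f.monotone (le_natAdd_zero a)
      rw [← hi] at h1
      exact left_of_le_left h1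
    · refine Or.inr ⟨h, fun a => ?_, fun b => ⟨j, by rw [hj, Subsingleton.elim b 0]⟩⟩
      have h1 : f (Fin.castAdd 1 a) < f (Fin.natAdd k 0) := f.strictMono (castAdd_lt_natAdd _ _)
      rcases mem_range_castAdd_or_natAdd (f (Fin.castAdd 1 a)) with h2 | ⟨j', hj'⟩
      · exact h2
      · rw [← hj, ← hj', Subsingleton.elim j j'] at h1
        exact absurd h1 (lt_irrefl _)
  · rintro f ⟨-, h1⟩ ⟨-, -, h2⟩
    obtain ⟨i, hi⟩ := h1 (Fin.natAdd k 0)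
    obtain ⟨j, hj⟩ := h2 0
    exact (castAdd_lt_natAdd i j).ne (hi.trans hj.symm)

/-- The last entry of a copy lies below an entry of the `q` part, so it cannot be the final maximum.
-/
theorem copies_ominus_oplus_one (q : Pattern (k + 1)) (t : Pattern (m + 1)) (p : Pattern n) :
    copies (ominus q t) (oplus p (incr 1)) = copies (ominus q t) p := by
  rw [← card_copies_in_range (Fin.castAddOrderEmb 1) (oplus_left_lt_left p (incr 1))]
  refine Nat.card_congr (Equiv.subtypeEquivRight fun f => ⟨fun h => ⟨h, fun a => ?_⟩, And.left⟩)
  set z : Fin (k + 1 + (m + 1)) := Fin.natAdd (k + 1) (Fin.last m) with hz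
  have haz : a ≤ z := by rw [Fin.le_def]; simp [hz]; omega
  have h1 := f.monotone haz
  rcases mem_range_castAdd_or_natAdd (f z) with ⟨i, hi⟩ | ⟨j, hj⟩
  · rw [← hi] at h1
    exact left_of_le_left h1
  · have h2 := (h z (Fin.castAdd (m + 1) 0)).2 (ominus_right_lt_left _ _ _ _)
    rw [← hj, Subsingleton.elim j 0] at h2
    exact absurd h2 (oplus_one_le_last _ _).not_gt

/-- If the last entry of the copy is in `p₁`, so is the whole copy. Otherwise the `t` part, having
that entry as maximum, lies in `p₂`, and the last entry of the `q` part decides in the same way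
whether that part lies in `p₁` or `p₂`. -/
theorem copies_ominus_ominus (q : Pattern k) (t : Pattern m) (p₁ : Pattern n) (p₂ : Pattern l) :
    copies (ominus (oplus q (incr 1)) (oplus t (incr 1))) (ominus p₁ p₂) =
      copies (ominus (oplus q (incr 1)) (oplus t (incr 1))) p₁ +
        (copies (oplus q (incr 1)) p₁ * copies (oplus t (incr 1)) p₂ +
          copies (ominus (oplus q (incr 1)) (oplus t (incr 1))) p₂) := by
  set q' := oplus q (incr 1) with hq'
  set t' := oplus t (incr 1) with ht'
  rw [← card_copies_in_range (q := ominus q' t') (Fin.castAddOrderEmb l) (ominus_left_lt_left p₁ p₂),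
    ← card_copies_in_range (q := ominus q' t') (Fin.natAddOrderEmb n) (ominus_right_lt_right p₁ p₂),
    ← card_copies_split (ominus_left_lt_left q' t') (ominus_right_lt_right q' t')
      (ominus_left_lt_left p₁ p₂) (ominus_right_lt_right p₁ p₂)
      (fun a b i j => iff_of_false (ominus_right_lt_left _ _ _ _).not_gt
        (ominus_right_lt_left _ _ _ _).not_gt)
      (fun a b i j => iff_of_true (ominus_right_lt_left _ _ _ _) (ominus_right_lt_left _ _ _ _)),
    ← card_subtype_eq_add (α := Fin (k + 1 + (m + 1)) ↪o Fin (n + l)) (fun _ => Iff.rfl)]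
  · refine card_subtype_eq_add (fun f => ⟨fun h => ?_,
      fun h => h.elim And.left fun h => h.elim And.left And.left⟩) ?_
    · rcases mem_range_castAdd_or_natAdd (f (Fin.natAdd (k + 1) (Fin.natAdd m 0))) with
        ⟨i, hi⟩ | ⟨j, hj⟩
      · refine Or.inl ⟨h, fun a => ?_⟩
        have ha : a ≤ Fin.natAdd (k + 1) (Fin.natAdd m 0) := by
          rw [Fin.le_def]; simp; omega
        have h1 := f.monotone ha
        rw [← hi] at h1
        exact left_of_le_left h1
      · have hr : ∀ b, ∃ j, Fin.natAdd n j = f (Fin.natAdd (k + 1) b) := fun b => by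
          have h1 := (h.le_iff (Fin.natAdd (k + 1) b) (Fin.natAdd (k + 1) (Fin.natAdd m 0))).2
            (not_lt.1 fun h2 => (oplus_one_le_last t b).not_gt
              ((ominus_right_lt_right _ _ _ _).1 h2))
          rw [← hj] at h1
          exact right_of_ominus_le h1
        rcases mem_range_castAdd_or_natAdd (f (Fin.castAdd (m + 1) (Fin.natAdd k 0))) with
          ⟨i, hi⟩ | ⟨j', hj'⟩
        · refine Or.inr (Or.inl ⟨h, fun a => ?_, hr⟩)
          have ha : Fin.castAdd (m + 1) a ≤ Fin.castAdd (m + 1) (Fin.natAdd k 0) :=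
            le_natAdd_zero a
          have h1 := f.monotone ha
          rw [← hi] at h1
          exact left_of_le_left h1
        · refine Or.inr (Or.inr ⟨h, fun a => ?_⟩)
          induction a using Fin.addCases with
          | right b => exact hr b
          | left a =>
            have h1 := (h.le_iff (Fin.castAdd (m + 1) a) (Fin.castAdd (m + 1) (Fin.natAdd k 0))).2
              (not_lt.1 fun h2 => (oplus_one_le_last q a).not_gt
                ((ominus_left_lt_left _ _ _ _).1 h2))
            rw [← hj'] at h1
            exact right_of_ominus_le h1
    · rintro f ⟨-, h1⟩ h2
      obtain ⟨i, hi⟩ := h1 (Fin.natAdd (k + 1) (Fin.natAdd m 0))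
      obtain ⟨j, hj⟩ : ∃ j, Fin.natAdd n j = f (Fin.natAdd (k + 1) (Fin.natAdd m 0)) :=
        h2.elim (fun h => h.2.2 _) (fun h => h.2 _)
      exact (castAdd_lt_natAdd i j).ne (hi.trans hj.symm)
  · rintro f ⟨-, h1, -⟩ ⟨-, h2⟩
    obtain ⟨i, hi⟩ := h1 (Fin.natAdd k 0)
    obtain ⟨j, hj⟩ := h2 (Fin.castAdd (m + 1) (Fin.natAdd k 0))
    exact (castAdd_lt_natAdd i j).ne (hi.trans hj.symm)

end Copies

end PermPattern

namespace PermPattern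

/-! ### Recursive structure of the 132-avoiding permutations. -/

section Avoiders

variable {a b k l m n N : ℕ}

theorem avoids_p132_iff {p : Pattern n} :
    Avoids p p132 ↔ ∀ x y z, x < y → y < z → p x < p z → ¬ p z < p y := by
  constructor
  · intro h x y z hxy hyz hxz hzy
    have hm : StrictMono ![x, y, z] := by
      rw [Fin.strictMono_iff_lt_succ]
      intro i
      fin_cases i
      · exact hxy
      · exact hyz
    refine h ⟨OrderEmbedding.ofStrictMono _ hm, fun i j => ?_⟩
    have e0 : p132 0 = 0 := by decide
    have e1 : p132 1 = 2 := by decide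
    have e2 : p132 2 = 1 := by decide
    fin_cases i <;> fin_cases j <;>
      simp [e0, e1, e2, hxz, hzy, hxz.not_gt, hzy.not_gt, hxz.trans hzy, (hxz.trans hzy).not_gt]
  · rintro h ⟨f, hf⟩
    refine h (f 0) (f 1) (f 2) (f.strictMono (by decide)) (f.strictMono (by decide)) ?_ ?_
    · rw [hf]; decide
    · rw [hf]; decide

theorem Avoids.of_embedding {p : Pattern N} {p' : Pattern n} (h : Avoids p p132) (g : Fin n ↪o Fin N)
    (hg : ∀ x y, p (g x) < p (g y) ↔ p' x < p' y) : Avoids p' p132 := by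
  rw [avoids_p132_iff] at h ⊢
  intro x y z hxy hyz
  rw [← hg, ← hg]
  exact h _ _ _ (g.strictMono hxy) (g.strictMono hyz)

theorem avoids_ominus_iff {p₁ : Pattern n} {p₂ : Pattern l} :
    Avoids (ominus p₁ p₂) p132 ↔ Avoids p₁ p132 ∧ Avoids p₂ p132 := by
  refine ⟨fun h => ⟨h.of_embedding (Fin.castAddOrderEmb l) (ominus_left_lt_left p₁ p₂),
    h.of_embedding (Fin.natAddOrderEmb n) (ominus_right_lt_right p₁ p₂)⟩, fun ⟨h₁, h₂⟩ => ?_⟩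
  rw [avoids_p132_iff] at h₁ h₂ ⊢
  intro x y z hxy hyz hxz hzy
  rcases mem_range_castAdd_or_natAdd z with ⟨z, rfl⟩ | ⟨z, rfl⟩
  · obtain ⟨y, rfl⟩ := left_of_le_left hyz.le
    obtain ⟨x, rfl⟩ := left_of_le_left hxy.le
    rw [ominus_left_lt_left] at hxz hzy
    exact h₁ x y z hxy hyz hxz hzy
  · obtain ⟨x, rfl⟩ := right_of_ominus_le hxz.le
    rcases mem_range_castAdd_or_natAdd y with ⟨y, rfl⟩ | ⟨y, rfl⟩
    · exact (castAdd_lt_natAdd _ _).not_gt hxy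
    · rw [ominus_right_lt_right] at hxz hzy
      exact h₂ x y z (by simpa using hxy) (by simpa using hyz) hxz hzy

theorem avoids_oplus_one_iff {p : Pattern n} :
    Avoids (oplus p (incr 1)) p132 ↔ Avoids p p132 := by
  refine ⟨fun h => h.of_embedding (Fin.castAddOrderEmb 1) (oplus_left_lt_left p (incr 1)),
    fun h => ?_⟩
  rw [avoids_p132_iff] at h ⊢
  intro x y z hxy hyz hxz hzy
  rcases mem_range_castAdd_or_natAdd z with ⟨z, rfl⟩ | ⟨z, rfl⟩
  · obtain ⟨y, rfl⟩ := left_of_le_left hyz.le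
    obtain ⟨x, rfl⟩ := left_of_le_left hxy.le
    rw [oplus_left_lt_left] at hxz hzy
    exact h x y z hxy hyz hxz hzy
  · rw [Subsingleton.elim z 0] at hzy
    exact (oplus_one_le_last p y).not_gt hzy

/-- The permutation with entries in order `L`, then the maximum, then `R`, where every entry of
`L` exceeds every entry of `R`. -/
def graft (L : Pattern a) (R : Pattern b) : Pattern (a + 1 + b) := ominus (oplus L (incr 1)) R

theorem avoids_graft_iff {L : Pattern a} {R : Pattern b} :
    Avoids (graft L R) p132 ↔ Avoids L p132 ∧ Avoids R p132 := by
  rw [graft, avoids_ominus_iff, avoids_oplus_one_iff]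

theorem oplus_injective {q q' : Pattern k} {t t' : Pattern m} (h : oplus q t = oplus q' t') :
    q = q' ∧ t = t' := by
  constructor
  · ext i
    rw [← oplus_castAdd q t, h, oplus_castAdd]
  · ext i
    have h1 := oplus_natAdd q t i
    rw [h, oplus_natAdd] at h1
    omega

theorem ominus_injective {q q' : Pattern k} {t t' : Pattern m} (h : ominus q t = ominus q' t') :
    q = q' ∧ t = t' := by
  constructor
  · ext i
    have h1 := ominus_castAdd q t i
    rw [h, ominus_castAdd] at h1
    omega
  · ext i
    rw [← ominus_natAdd q t, h, ominus_natAdd]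

theorem graft_apply_eq_max_iff (L : Pattern a) (R : Pattern b) (x : Fin (a + 1 + b)) :
    (graft L R x : ℕ) = a + b ↔ (x : ℕ) = a := by
  rw [graft]
  induction x using Fin.addCases with
  | left x =>
    rw [ominus_castAdd]
    induction x using Fin.addCases with
    | left x => rw [oplus_castAdd]; simp; omega
    | right x => rw [oplus_natAdd]; simp
  | right x => rw [ominus_natAdd]; simp; omega

/-- An entry before the maximum and a larger one after it would form a 132 with the maximum, so
everything up to the maximum exceeds everything after it. -/
theorem exists_eq_graft {p : Pattern (a + 1 + b)} (hp : Avoids p p132)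
    (hmax : (p (Fin.castAdd b (Fin.last a)) : ℕ) = a + b) :
    ∃ (L : Pattern a) (R : Pattern b), p = graft L R := by
  have hr : ∀ j : Fin b, (p (Fin.natAdd (a + 1) j) : ℕ) < b := by
    intro j
    by_contra! hj
    have hlt : ∀ i : Fin (a + 1), p (Fin.natAdd (a + 1) j) < p (Fin.castAdd b i) := by
      have hz : p (Fin.natAdd (a + 1) j) < p (Fin.castAdd b (Fin.last a)) := by
        refine lt_of_le_of_ne (Fin.le_def.2 (by omega)) fun e => ?_
        exact (castAdd_lt_natAdd _ _).ne (p.injective e).symm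
      intro i
      rcases (Fin.le_last i).eq_or_lt with rfl | hi
      · exact hz
      · refine lt_of_le_of_ne (not_lt.1 fun h => ?_) fun e =>
          (castAdd_lt_natAdd _ _).ne (p.injective e).symm
        exact avoids_p132_iff.1 hp _ _ _ (show Fin.castAdd b i < Fin.castAdd b (Fin.last a) from hi)
          (castAdd_lt_natAdd _ _) h hz
    -- A right entry of value at least `b` has at most `a` values above it, but `a + 1` entries
    -- exceed it.
    have hc := Finset.card_le_card_of_injOn (s := Finset.univ)
      (t := Finset.Ioi (p (Fin.natAdd (a + 1) j))) (fun i : Fin (a + 1) => p (Fin.castAdd b i))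
      (fun i _ => by simpa using hlt i)
      (fun i _ i' _ h => Fin.castAdd_injective _ _ (p.injective h))
    rw [Finset.card_univ, Fintype.card_fin, Fin.card_Ioi] at hc
    omega
  obtain ⟨q, R, rfl⟩ := exists_eq_ominus p hr
  rw [ominus_castAdd] at hmax
  obtain ⟨L, rfl⟩ := exists_eq_oplus_one q (Fin.ext (by simp; omega))
  exact ⟨L, R, rfl⟩

/-- Transport of a pattern along an equality of lengths. -/
def castPattern (h : k = n) (p : Pattern k) : Pattern n := h ▸ p

/-- Weights are families over all lengths so that they are invariant under casts. -/
theorem apply_castPattern {M : Type*} (w : ∀ n, Pattern n → M) (h : k = n) (p : Pattern k) :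
    w n (castPattern h p) = w k p := by
  subst h; rfl

theorem avoids_castPattern (h : k = n) {p : Pattern k} :
    Avoids (castPattern h p) p132 ↔ Avoids p p132 := by
  subst h; rfl

theorem castPattern_injective (h : k = n) : Function.Injective (castPattern h) := by
  subst h; exact fun _ _ h => h

theorem castPattern_graft_apply_eq_max_iff (h : a + 1 + b = n + 1) (L : Pattern a) (R : Pattern b)
    (x : Fin (n + 1)) : (castPattern h (graft L R) x : ℕ) = n ↔ (x : ℕ) = a := by
  obtain rfl : n = a + b := by omega
  have key : ∀ N (h : a + 1 + b = N) (x : Fin N),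
      (castPattern h (graft L R) x : ℕ) = a + b ↔ (x : ℕ) = a := by
    rintro N rfl x
    exact graft_apply_eq_max_iff L R x
  exact key _ h x

theorem exists_eq_castPattern_graft {p : Pattern N} (hp : Avoids p p132) (h : a + 1 + b = N)
    {x : Fin N} (hx : (x : ℕ) = a) (hmax : (p x : ℕ) = a + b) :
    ∃ (L : Pattern a) (R : Pattern b), castPattern h (graft L R) = p := by
  subst h
  obtain rfl : x = Fin.castAdd b (Fin.last a) := Fin.ext (by simpa using hx)
  obtain ⟨L, R, rfl⟩ := exists_eq_graft hp hmax
  exact ⟨L, R, rfl⟩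

open Classical in
/-- The finset of `132`-avoiding permutations of length `n`. -/
noncomputable def avoiders (n : ℕ) : Finset (Pattern n) :=
  (Finset.univ : Finset (Pattern n)).filter (fun p => Avoids p p132)

theorem mem_avoiders {p : Pattern n} : p ∈ avoiders n ↔ Avoids p p132 := by
  simp [avoiders]

theorem sum_avoiders_succ {M : Type*} [AddCommMonoid M] (w : ∀ n, Pattern n → M) (n : ℕ) :
    ∑ p ∈ avoiders (n + 1), w (n + 1) p = ∑ x ∈ Finset.HasAntidiagonal.antidiagonal n,
      ∑ L ∈ avoiders x.1, ∑ R ∈ avoiders x.2, w (x.1 + 1 + x.2) (graft L R) := by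
  simp_rw [← Finset.sum_product']
  rw [Finset.sum_sigma']
  symm
  have hlen : ∀ x : Σ x : ℕ × ℕ, Pattern x.1 × Pattern x.2,
      x ∈ (Finset.HasAntidiagonal.antidiagonal n).sigma (fun x => avoiders x.1 ×ˢ avoiders x.2) →
      x.1.1 + 1 + x.1.2 = n + 1 := by
    intro x hx
    have h := Finset.HasAntidiagonal.mem_antidiagonal.1 (Finset.mem_sigma.1 hx).1
    omega
  refine Finset.sum_bij (fun x hx => castPattern (hlen x hx) (graft x.2.1 x.2.2)) ?_ ?_ ?_ ?_
  · intro x hx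
    rw [mem_avoiders, avoids_castPattern, avoids_graft_iff]
    have h := Finset.mem_product.1 (Finset.mem_sigma.1 hx).2
    exact ⟨mem_avoiders.1 h.1, mem_avoiders.1 h.2⟩
  · rintro ⟨⟨a, b⟩, L, R⟩ hx ⟨⟨a', b'⟩, L', R'⟩ hx' h
    have e := hlen _ hx
    have e' := hlen _ hx'
    dsimp only at e e' h
    -- The position of the maximum recovers the length of `L`.
    have h1 := (castPattern_graft_apply_eq_max_iff e L R ⟨a, by omega⟩).2 rfl
    rw [h, castPattern_graft_apply_eq_max_iff] at h1
    obtain rfl : a = a' := h1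
    obtain rfl : b = b' := by omega
    obtain ⟨h2, rfl⟩ := ominus_injective (castPattern_injective _ h)
    obtain ⟨rfl, -⟩ := oplus_injective h2
    rfl
  · intro p hp
    rw [mem_avoiders] at hp
    have hx := p.apply_symm_apply (Fin.last n)
    set x := p.symm (Fin.last n)
    have e : (x : ℕ) + 1 + (n - x) = n + 1 := by omega
    obtain ⟨L, R, h⟩ := exists_eq_castPattern_graft hp e rfl (by rw [hx]; simp; omega)
    have h1 : Avoids L p132 ∧ Avoids R p132 := by
      rw [← avoids_graft_iff, ← avoids_castPattern e, h]
      exact hp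
    refine ⟨⟨(x, n - x), L, R⟩, ?_, h⟩
    simp [mem_avoiders, h1]
    omega
  · intro x hx
    exact (apply_castPattern w (hlen x hx) _).symm

end Avoiders

/-! ### Functional equations for the generating functions. -/

section GeneratingFunction

open PowerSeries

variable {k m n : ℕ}

/-- The generating function of the total weight of the `132`-avoiding permutations of
each length. -/
noncomputable def genFun (w : ∀ n, Pattern n → ℤ) : ℤ⟦X⟧ :=
  PowerSeries.mk fun n => ∑ p ∈ avoiders n, w n p

/-- The generating function of `S n p132 q`. -/
noncomputable def copiesGenFun (q : Pattern k) : ℤ⟦X⟧ := genFun fun _ p => copies q p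

theorem coeff_copiesGenFun (q : Pattern k) (n : ℕ) :
    PowerSeries.coeff n (copiesGenFun q) = (S n p132 q : ℤ) := by
  simp [copiesGenFun, genFun, S, avoiders]

/-- The generating function of the number of `132`-avoiding permutations. -/
noncomputable def avoidersGenFun : ℤ⟦X⟧ := genFun fun _ _ => 1

theorem genFun_mul (w₁ w₂ : ∀ n, Pattern n → ℤ) :
    genFun w₁ * genFun w₂ = PowerSeries.mk fun n => ∑ x ∈ Finset.HasAntidiagonal.antidiagonal n,
      ∑ L ∈ avoiders x.1, ∑ R ∈ avoiders x.2, w₁ _ L * w₂ _ R := by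
  ext n
  rw [PowerSeries.coeff_mul, PowerSeries.coeff_mk]
  refine Finset.sum_congr rfl fun x _ => ?_
  rw [genFun, genFun, PowerSeries.coeff_mk, PowerSeries.coeff_mk, Finset.sum_mul_sum]

theorem copies_eq_zero_of_lt (q : Pattern k) (p : Pattern n) (h : n < k) : copies q p = 0 := by
  rw [copies, Nat.card_eq_zero]
  refine Or.inl ⟨fun f => ?_⟩
  have := Fintype.card_le_of_injective _ f.1.injective
  simp at this
  omega

/-- Non-emptiness of `q` makes the constant term vanish; the other coefficients come from the
decomposition at the maximum. -/
theorem copiesGenFun_eq (q : Pattern (k + 1)) :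
    copiesGenFun q = X * PowerSeries.mk fun n => ∑ x ∈ Finset.HasAntidiagonal.antidiagonal n,
      ∑ L ∈ avoiders x.1, ∑ R ∈ avoiders x.2, (copies q (graft L R) : ℤ) := by
  ext n
  cases n with
  | zero =>
    rw [PowerSeries.coeff_zero_X_mul, copiesGenFun, genFun, PowerSeries.coeff_mk]
    exact Finset.sum_eq_zero fun p _ => by rw [copies_eq_zero_of_lt q p (Nat.succ_pos k)]; rfl
  | succ n =>
    rw [PowerSeries.coeff_succ_X_mul, copiesGenFun, genFun, PowerSeries.coeff_mk,
      PowerSeries.coeff_mk]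
    exact sum_avoiders_succ (fun _ p => (copies q p : ℤ)) n

theorem copiesGenFun_oplus_one (q : Pattern k) :
    (1 - 2 * (X * avoidersGenFun)) * copiesGenFun (oplus q (incr 1)) =
      X * avoidersGenFun * copiesGenFun q := by
  have h : copiesGenFun (oplus q (incr 1)) =
      X * (copiesGenFun (oplus q (incr 1)) * avoidersGenFun + copiesGenFun q * avoidersGenFun +
        avoidersGenFun * copiesGenFun (oplus q (incr 1))) := by
    conv_lhs => rw [copiesGenFun_eq]
    congr 1
    simp only [copiesGenFun, avoidersGenFun, genFun_mul]
    ext n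
    simp only [map_add, PowerSeries.coeff_mk, ← Finset.sum_add_distrib, graft,
      copies_oplus_one_ominus, copies_oplus_one_oplus_one, Nat.cast_add, mul_one, one_mul]
  linear_combination h

theorem copiesGenFun_ominus (q : Pattern k) (t : Pattern m) :
    (1 - 2 * (X * avoidersGenFun)) *
        copiesGenFun (ominus (oplus q (incr 1)) (oplus t (incr 1))) =
      X * (copiesGenFun (oplus q (incr 1)) + copiesGenFun q) *
        copiesGenFun (oplus t (incr 1)) := by
  set Q := ominus (oplus q (incr 1)) (oplus t (incr 1)) with hQ
  have h : copiesGenFun Q =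
      X * (copiesGenFun Q * avoidersGenFun +
        (copiesGenFun (oplus q (incr 1)) * copiesGenFun (oplus t (incr 1)) +
          copiesGenFun q * copiesGenFun (oplus t (incr 1))) +
        avoidersGenFun * copiesGenFun Q) := by
    conv_lhs => rw [copiesGenFun_eq (k := k + 1 + m) Q]
    congr 1
    simp only [copiesGenFun, avoidersGenFun, genFun_mul]
    ext n
    simp only [map_add, PowerSeries.coeff_mk, ← Finset.sum_add_distrib, graft]
    refine Finset.sum_congr rfl fun x _ => Finset.sum_congr rfl fun L _ =>
      Finset.sum_congr rfl fun R _ => ?_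
    rw [hQ, copies_ominus_ominus, copies_ominus_oplus_one, copies_oplus_one_oplus_one]
    push_cast
    ring
  linear_combination h

theorem one_sub_ne_zero : (1 - 2 * (X * avoidersGenFun) : ℤ⟦X⟧) ≠ 0 := by
  intro h
  have := congrArg PowerSeries.constantCoeff h
  simp at this

theorem copiesGenFun_oplus_incr (q : Pattern k) (u : ℕ) :
    (1 - 2 * (X * avoidersGenFun)) ^ u * copiesGenFun (oplus q (incr u)) =
      (X * avoidersGenFun) ^ u * copiesGenFun q := by
  induction u with
  | zero =>
    have e : oplus q (incr 0) = q := by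
      ext x
      exact oplus_castAdd q (incr 0) x
    rw [e, pow_zero, pow_zero]
  | succ u ih =>
    rw [oplus_incr_succ]
    have h := copiesGenFun_oplus_one (oplus q (incr u))
    linear_combination (X * avoidersGenFun) * ih +
      (1 - 2 * (X * avoidersGenFun)) ^ u * h

theorem copiesGenFun_oplus_incr_ominus (q : Pattern k) (t : Pattern m) (u : ℕ) :
    (1 - 2 * (X * avoidersGenFun)) ^ u *
        copiesGenFun (ominus (oplus (oplus q (incr 1)) (incr u)) (oplus t (incr 1))) =
      (X * avoidersGenFun) ^ u * copiesGenFun (ominus (oplus q (incr 1)) (oplus t (incr 1))) := by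
  have h₁ := copiesGenFun_ominus q t
  cases u with
  | zero =>
    have e : oplus (oplus q (incr 1)) (incr 0) = oplus q (incr 1) := by
      ext x
      exact oplus_castAdd (oplus q (incr 1)) (incr 0) x
    rw [e, pow_zero, pow_zero]
  | succ u =>
    rw [oplus_incr_succ]
    -- With a last 1 split off the inserted run, the skew-sum equation applies to `q ⊕ 1 ⊕ i_u` in
    -- place of `q`; `h₃`, `h₄`, `h₅` then reduce both of its terms to those of `h₁`.
    have h₂ := copiesGenFun_ominus (oplus (oplus q (incr 1)) (incr u)) t
    have h₃ := copiesGenFun_oplus_incr (oplus q (incr 1)) u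
    have h₄ := copiesGenFun_oplus_one (oplus (oplus q (incr 1)) (incr u))
    have h₅ := copiesGenFun_oplus_one q
    refine mul_left_cancel₀ one_sub_ne_zero ?_
    set D : ℤ⟦X⟧ := 1 - 2 * (X * avoidersGenFun)
    set Y : ℤ⟦X⟧ := X * avoidersGenFun
    set T := copiesGenFun (oplus t (incr 1))
    linear_combination D ^ (u + 1) * h₂ - Y ^ (u + 1) * h₁ + D ^ u * X * T * h₄ +
      (X * T * Y + D * X * T) * h₃ + Y ^ u * X * T * h₅

end GeneratingFunction

theorem S_congr_of_pow_mul {k m : ℕ} {q : Pattern k} {t : Pattern m} {D : PowerSeries ℤ}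
    (hD : D ≠ 0) {u : ℕ} (h : D ^ u * copiesGenFun q = D ^ u * copiesGenFun t) (n : ℕ) :
    S n p132 q = S n p132 t := by
  have h1 := mul_left_cancel₀ (pow_ne_zero u hD) h
  have h2 := congrArg (PowerSeries.coeff n) h1
  rw [coeff_copiesGenFun, coeff_copiesGenFun] at h2
  exact_mod_cast h2

end PermPattern
theorem corollary4p2 {k m : ℕ} (q : PermPattern.Pattern k) (t : PermPattern.Pattern m)
    (hq : PermPattern.EndsInLargest q) (ht : PermPattern.EndsInLargest t)
    (u v : ℕ) (hv : 1 ≤ v) (hvu : v < u) (n : ℕ) :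
    PermPattern.S n PermPattern.p132
        (PermPattern.oplus
          (PermPattern.ominus (PermPattern.oplus q (PermPattern.incr v)) t)
          (PermPattern.incr (u - v))) =
      PermPattern.S n PermPattern.p132
        (PermPattern.oplus (PermPattern.ominus q t) (PermPattern.incr u)) ∧
    PermPattern.S n PermPattern.p132
        (PermPattern.oplus (PermPattern.ominus q t) (PermPattern.incr u)) =
      PermPattern.S n PermPattern.p132
        (PermPattern.ominus (PermPattern.oplus q (PermPattern.incr u)) t) := by
  open PermPattern in
  obtain ⟨k, rfl⟩ : ∃ k', k = k' + 1 := ⟨k - 1, by have := hq.1; omega⟩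
  obtain ⟨m, rfl⟩ : ∃ m', m = m' + 1 := ⟨m - 1, by have := ht.1; omega⟩
  obtain ⟨q, rfl⟩ := hq.exists_eq_oplus_one
  obtain ⟨t, rfl⟩ := ht.exists_eq_oplus_one
  have h₁ := copiesGenFun_oplus_incr
    (ominus (oplus (oplus q (incr 1)) (incr v)) (oplus t (incr 1))) (u - v)
  have h₂ := copiesGenFun_oplus_incr_ominus q t v
  have h₃ := copiesGenFun_oplus_incr (ominus (oplus q (incr 1)) (oplus t (incr 1))) u
  have h₄ := copiesGenFun_oplus_incr_ominus q t u
  refine ⟨S_congr_of_pow_mul one_sub_ne_zero (u := u) ?_ n,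
    S_congr_of_pow_mul one_sub_ne_zero (u := u) (h₃.trans h₄.symm) n⟩
  rw [h₃]
  -- The factor (Y/D)^u splits as (Y/D)^(w+1), from the outer run, times (Y/D)^v, from the inner
  -- one.
  obtain ⟨w, rfl⟩ := Nat.exists_eq_add_of_lt hvu
  rw [show v + w + 1 - v = w + 1 by omega] at h₁ ⊢
  linear_combination (1 - 2 * (PowerSeries.X * avoidersGenFun)) ^ v * h₁ +
    (PowerSeries.X * avoidersGenFun) ^ (w + 1) * h₂
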